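/- Let $n\ge 0$ and write $B_r=\{x\in\mathbb R^n:|x|<r\}$. There is a constant $C<\infty$ depending only on $n$ such that the following holds. Let $f:B_1\to\mathbb R$ be continuous and let $u\in C^1(B_1)$ solve $\Delta u=f$ in $B_1$ in the sense of distributions, i.e. $\int_{B_1}u\,\Delta\varphi\,dx=\int_{B_1}f\varphi\,dx$ for all $\varphi\in C_c^\infty(B_1)$. For $r>0$ put $\omega(r)=\sup\{|f(x)-f(y)|: x,y\in B_1,\ |x-y|<r\}\in[0,\infty]$. Then: (a) for all $x,y\in B_{1/2}$, with $d=|x-y|$, $$|Du(x)-Du(y)|\le C\,d\left(\sup_{B_1}|u|+\sup_{B_1}|f|+\int_d^1\frac{\omega(r)}{r}\,dr\right),$$ where suprema and the integral take values in $[0,\infty]$ and the right-hand side is $0$ if $d=0$; (b) the modulus of continuity of $Du$ on $B_{1/2}$ is $o(r\log r)$: $$\lim_{r\to0^+}\frac{\sup\{|Du(x)-Du(y)|: x,y\in B_{1/2},\ |x-y|<r\}}{r\,|\log r|}=0.$$ -/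

import Mathlib

open Set Filter Topology MeasureTheory Metric
open scoped ENNReal NNReal ContDiff

/-- `u` solves `Δ u = f` in the open set `U ⊆ ℝⁿ` in the sense of distributions:
`∫_U u Δφ = ∫_U f φ` for every smooth `φ` with compact support in `U`. -/
def IsWeakPoissonSolution {n : ℕ} (U : Set (EuclideanSpace ℝ (Fin n)))
    (u f : EuclideanSpace ℝ (Fin n) → ℝ) : Prop :=
  ∀ φ : EuclideanSpace ℝ (Fin n) → ℝ, ContDiff ℝ ∞ φ → HasCompactSupport φ → tsupport φ ⊆ U →
    ∫ x in U, u x * Laplacian.laplacian φ x = ∫ x in U, f x * φ x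

/-- The modulus of continuity of `g` on `S`, with values in `[0, ∞]`:
`r ↦ sup {|g x - g y| : x, y ∈ S, |x - y| < r}`. -/
noncomputable def modulusOn {X Y : Type*} [PseudoMetricSpace X] [PseudoEMetricSpace Y]
    (S : Set X) (g : X → Y) (r : ℝ) : ℝ≥0∞ :=
  ⨆ (x ∈ S) (y ∈ S) (_ : dist x y < r), edist (g x) (g y)

/-! Potential theory is replaced by mollifiers `t ^ (-n) φ(z / t)` whose derivative in the scale `t`
is a Laplacian. If `φ` is radial, then `z ↦ φ(z) z` is the gradient of a radial bump `ψ`, so `nφ +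
z·∇φ = Δψ`, and this says that `d/dt [t ^ (-n) φ(z / t)] = -t ^ (-n - 1) (Δψ)(z / t)`. Tested
against `u`, the Laplacian moves onto `u` and becomes `f`, with a gain of `t ^ 2`. The relation
survives differentiation of `φ` and `ψ`, each derivative costing one power of `t`.

With one derivative, the mollified `∂ᵥu` changes in `t` at a rate bounded by `sup |f|`. It tends to
`∂ᵥu · ∫ φ` as `t → 0`, so at scale `d` its error is `O(d sup |f|)`
(`abs_fderiv_sub_kernelMean_le`). With two derivatives the rate is at most a constant times `ω(t) /
t`, because the kernel has mean zero and `f` may be replaced by `f - f(x)`. Integration from `d` to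
`1`, where the value at scale `1` is controlled by `sup |u|`, bounds the mollified second
derivatives at scale `d` (`abs_kernelMean_two_sub_le`). Taking `d = |x - y|` and the mean value
theorem along the segment gives (a).

For (b), suprema over `B_1` may be infinite, so the estimate is proved for any set `S` containing
the balls of radius `1/4` about points of `B_{1/2}`. On the closed ball of radius `3/4`, `f` is
bounded and uniformly continuous, so its modulus tends to `0` and the Dini integral is `o(|log r|)`.
-/

/-- The directional derivative of `g` in the direction `v`. -/
noncomputable def dirDeriv {E : Type*} [NormedAddCommGroup E] [NormedSpace ℝ E]
    (v : E) (g : E → ℝ) : E → ℝ :=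
  fun z => fderiv ℝ g z v

/-! ### Calculus of directional derivatives -/

section DirDeriv

variable {E : Type*} [NormedAddCommGroup E] [NormedSpace ℝ E]

theorem ContDiff.dirDeriv {g : E → ℝ} (hg : ContDiff ℝ ∞ g) (v : E) :
    ContDiff ℝ ∞ (dirDeriv v g) :=
  (hg.fderiv_right (m := ∞) (by simp)).clm_apply contDiff_const

theorem tsupport_dirDeriv_subset (g : E → ℝ) (v : E) : tsupport (dirDeriv v g) ⊆ tsupport g :=
  tsupport_fderiv_apply_subset ℝ v

theorem dirDeriv_dirDeriv {g : E → ℝ} (hg : ContDiff ℝ ∞ g) (v w z : E) :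
    dirDeriv w (dirDeriv v g) z = fderiv ℝ (fderiv ℝ g) z w v := by
  have h : DifferentiableAt ℝ (fderiv ℝ g) z :=
    (hg.fderiv_right (m := ∞) (by simp)).differentiable (by simp) z
  have := (h.hasFDerivAt.clm_apply (hasFDerivAt_const v z)).fderiv
  change fderiv ℝ (fun y => fderiv ℝ g y v) z w = _
  rw [this]
  simp

theorem dirDeriv_comm {g : E → ℝ} (hg : ContDiff ℝ ∞ g) (v w : E) :
    dirDeriv w (dirDeriv v g) = dirDeriv v (dirDeriv w g) := by
  ext z
  rw [dirDeriv_dirDeriv hg, dirDeriv_dirDeriv hg]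
  exact ((contDiff_infty.1 hg 2).contDiffAt.isSymmSndFDerivAt (by simp)) w v

theorem dirDeriv_comp_smul_sub {g : E → ℝ} (hg : ContDiff ℝ ∞ g) (v : E) (c : ℝ) (x : E) :
    dirDeriv v (fun y => g (c • (x - y))) = fun y => -c * dirDeriv v g (c • (x - y)) := by
  ext y
  have h1 : HasFDerivAt (fun y : E => c • (x - y)) (c • (-ContinuousLinearMap.id ℝ E)) y :=
    ((hasFDerivAt_id y).const_sub x).const_smul c
  have h2 := ((hg.differentiable (by simp) (c • (x - y))).hasFDerivAt.comp y h1).fderiv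
  simp only [_root_.dirDeriv]
  have h3 : (fun y => g (c • (x - y))) = g ∘ fun y => c • (x - y) := rfl
  rw [h3, h2]
  simp

theorem dirDeriv_const_mul {g : E → ℝ} (hg : ContDiff ℝ ∞ g) (v : E) (c : ℝ) :
    dirDeriv v (fun y => c * g y) = fun y => c * dirDeriv v g y := by
  ext y
  simp only [_root_.dirDeriv]
  rw [fderiv_const_mul (hg.differentiable (by simp) y)]
  simp

/-- Differentiating the Euler operator `g ↦ ⟨z, ∇g(z)⟩`. -/
theorem dirDeriv_euler {g : E → ℝ} (hg : ContDiff ℝ ∞ g) (v z : E) :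
    dirDeriv v (fun z => fderiv ℝ g z z) z = dirDeriv v g z + fderiv ℝ (dirDeriv v g) z z := by
  have h : DifferentiableAt ℝ (fderiv ℝ g) z :=
    (hg.fderiv_right (m := ∞) (by simp)).differentiable (by simp) z
  have h1 := (h.hasFDerivAt.clm_apply (hasFDerivAt_id z)).fderiv
  have h2 : fderiv ℝ (dirDeriv v g) z z = fderiv ℝ (fderiv ℝ g) z z v :=
    dirDeriv_dirDeriv hg v z z
  rw [h2, ((contDiff_infty.1 hg 2).contDiffAt.isSymmSndFDerivAt (by simp) : IsSymmSndFDerivAt ℝ g z) z v]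
  simp only [_root_.dirDeriv]
  simp only [id] at h1
  rw [h1]
  simp

end DirDeriv

/-! ### The Laplacian and kernel pairs -/

section Laplacian

variable {n : ℕ}

local notation "𝔼" => EuclideanSpace ℝ (Fin n)

theorem laplacian_eq_sum_dirDeriv {g : 𝔼 → ℝ} (hg : ContDiff ℝ ∞ g) :
    Laplacian.laplacian g = fun z => ∑ i, dirDeriv (EuclideanSpace.basisFun (Fin n) ℝ i)
      (dirDeriv (EuclideanSpace.basisFun (Fin n) ℝ i) g) z := by
  rw [InnerProductSpace.laplacian_eq_iteratedFDeriv_orthonormalBasis g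
    (EuclideanSpace.basisFun (Fin n) ℝ)]
  ext z
  refine Finset.sum_congr rfl fun i _ => ?_
  rw [iteratedFDeriv_two_apply, dirDeriv_dirDeriv hg]
  simp

theorem ContDiff.laplacian_smooth {g : 𝔼 → ℝ} (hg : ContDiff ℝ ∞ g) :
    ContDiff ℝ ∞ (Laplacian.laplacian g) := by
  rw [laplacian_eq_sum_dirDeriv hg]
  exact ContDiff.sum fun i _ => (hg.dirDeriv _).dirDeriv _

theorem laplacian_eq_zero_of_notMem_tsupport {g : 𝔼 → ℝ} (hg : ContDiff ℝ ∞ g) {z : 𝔼}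
    (hz : z ∉ tsupport g) : Laplacian.laplacian g z = 0 := by
  rw [laplacian_eq_sum_dirDeriv hg]
  refine Finset.sum_eq_zero fun i _ => image_eq_zero_of_notMem_tsupport fun h => hz ?_
  exact tsupport_dirDeriv_subset _ _ (tsupport_dirDeriv_subset _ _ h)

theorem dirDeriv_laplacian {g : 𝔼 → ℝ} (hg : ContDiff ℝ ∞ g) (v : 𝔼) :
    dirDeriv v (Laplacian.laplacian g) = Laplacian.laplacian (dirDeriv v g) := by
  rw [laplacian_eq_sum_dirDeriv hg, laplacian_eq_sum_dirDeriv (hg.dirDeriv v)]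
  ext z
  have h : ∀ i ∈ Finset.univ, DifferentiableAt ℝ (dirDeriv (EuclideanSpace.basisFun (Fin n) ℝ i)
      (dirDeriv (EuclideanSpace.basisFun (Fin n) ℝ i) g)) z :=
    fun i _ => ((hg.dirDeriv _).dirDeriv _).differentiable (by simp) z
  have h1 := fderiv_fun_sum h
  change fderiv ℝ _ z v = _
  rw [h1, sum_apply]
  refine Finset.sum_congr rfl fun i _ => ?_
  rw [dirDeriv_comm hg v, dirDeriv_comm (hg.dirDeriv _) v]
  rfl

theorem laplacian_comp_smul_sub {g : 𝔼 → ℝ} (hg : ContDiff ℝ ∞ g) (c : ℝ) (x : 𝔼) :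
    Laplacian.laplacian (fun y => g (c • (x - y))) =
      fun y => c ^ 2 * Laplacian.laplacian g (c • (x - y)) := by
  have hc : ∀ {h : 𝔼 → ℝ}, ContDiff ℝ ∞ h → ContDiff ℝ ∞ (fun y => h (c • (x - y))) :=
    fun hh => hh.comp ((contDiff_const.sub contDiff_id).const_smul c)
  rw [laplacian_eq_sum_dirDeriv (hc hg), laplacian_eq_sum_dirDeriv hg]
  ext y
  rw [Finset.mul_sum]
  refine Finset.sum_congr rfl fun i _ => ?_
  rw [dirDeriv_comp_smul_sub hg, dirDeriv_const_mul (hc (hg.dirDeriv _)),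
    dirDeriv_comp_smul_sub (hg.dirDeriv _)]
  ring

/-- Smooth kernels `K`, `L` supported in the ball of radius `1/4` for which
`t ↦ t ^ (-(n + m)) K(z / t)` has derivative `-t ^ (-(n + m + 1)) (Δ L)(z / t)`. -/
structure IsKernelPair (m : ℕ) (K L : 𝔼 → ℝ) : Prop where
  contDiff_fst : ContDiff ℝ ∞ K
  contDiff_snd : ContDiff ℝ ∞ L
  tsupport_fst : tsupport K ⊆ ball 0 (1 / 4)
  tsupport_snd : tsupport L ⊆ ball 0 (1 / 4)
  euler : ∀ z, ((n : ℝ) + m) * K z + fderiv ℝ K z z = Laplacian.laplacian L z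

theorem hasCompactSupport_of_tsupport_subset_ball {K : 𝔼 → ℝ} {r : ℝ}
    (h : tsupport K ⊆ ball 0 r) : HasCompactSupport K :=
  (isCompact_closedBall (0 : 𝔼) r).of_isClosed_subset (isClosed_tsupport K)
    (h.trans ball_subset_closedBall)

/-- The Laplacian commutes with `∂ᵥ`, while the commutator of `∂ᵥ` with the Euler operator `z·∇` is
`∂ᵥ` itself; this extra term raises `m` by one. -/
theorem IsKernelPair.dirDeriv {m : ℕ} {K L : 𝔼 → ℝ} (h : IsKernelPair m K L) (v : 𝔼) :
    IsKernelPair (m + 1) (dirDeriv v K) (dirDeriv v L) where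
  contDiff_fst := h.contDiff_fst.dirDeriv v
  contDiff_snd := h.contDiff_snd.dirDeriv v
  tsupport_fst := (tsupport_dirDeriv_subset _ _).trans h.tsupport_fst
  tsupport_snd := (tsupport_dirDeriv_subset _ _).trans h.tsupport_snd
  euler z := by
    rw [← dirDeriv_laplacian h.contDiff_snd, ← funext h.euler]
    have hK := h.contDiff_fst
    have h1 : DifferentiableAt ℝ (fun z => ((n : ℝ) + m) * K z) z :=
      (contDiff_const.mul hK).differentiable (by simp) z
    have h2 : DifferentiableAt ℝ (fun z => fderiv ℝ K z z) z :=
      ((hK.fderiv_right (m := ∞) (by simp)).clm_apply contDiff_id).differentiable (by simp) z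
    have h3 : _root_.dirDeriv v (fun z => ((n : ℝ) + m) * K z + fderiv ℝ K z z) z =
        _root_.dirDeriv v (fun z => ((n : ℝ) + m) * K z) z +
          _root_.dirDeriv v (fun z => fderiv ℝ K z z) z := by
      simp only [_root_.dirDeriv]
      rw [fderiv_fun_add h1 h2]
      rfl
    rw [h3, dirDeriv_euler hK, dirDeriv_const_mul hK]
    push_cast
    ring

/-- Take `φ(z) = P'(|z|²)` and `ψ(z) = P(|z|²) / 2`. Then `∇ψ = φ(z) z`, whose divergence is `nφ +
z·∇φ`. Monotonicity of `P` makes `φ` nonnegative. -/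
theorem exists_isKernelPair (hn : n ≠ 0) :
    ∃ φ ψ : 𝔼 → ℝ, IsKernelPair 0 φ ψ ∧ 0 < ∫ z, φ z := by
  set P : ℝ → ℝ := fun s => -expNegInvGlue (1 - 32 * s) with hP
  have hPc : ContDiff ℝ ∞ P :=
    (expNegInvGlue.contDiff.comp (contDiff_const.sub (contDiff_const.mul contDiff_id))).neg
  have hP0 : ∀ s, 1 / 32 ≤ s → P s = 0 := fun s hs => by
    simp only [hP, neg_eq_zero]
    exact expNegInvGlue.zero_of_nonpos (by linarith)
  have hPd : ContDiff ℝ ∞ (deriv P) := by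
    have := (contDiff_infty_iff_deriv (𝕜 := ℝ)).1 hPc
    exact this.2
  have hmono : Monotone P := fun a b hab => by
    simp only [hP, neg_le_neg_iff]
    exact expNegInvGlue.monotone (by linarith)
  have hd0 : ∀ s, 1 / 32 < s → deriv P s = 0 := fun s hs => by
    have : P =ᶠ[𝓝 s] fun _ => 0 := by
      filter_upwards [Ioi_mem_nhds hs] with r hr using hP0 r (le_of_lt hr)
    rw [this.deriv_eq, deriv_const]
  have hsupp : ∀ g : 𝔼 → ℝ, (∀ z, 1 / 32 < ‖z‖ ^ 2 → g z = 0) →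
      tsupport g ⊆ ball 0 (1 / 4) := by
    intro g hg
    -- The radius `1/5` fits strictly between the two: `1/32 < 1/25 < 1/16`.
    have h1 : tsupport g ⊆ closedBall 0 (1 / 5) := by
      refine closure_minimal (fun z hz => ?_) isClosed_closedBall
      by_contra hz'
      rw [mem_closedBall_zero_iff, not_le] at hz'
      exact hz (hg z (by nlinarith))
    exact h1.trans (closedBall_subset_ball (by norm_num))
  have hφc : ContDiff ℝ ∞ (fun z : 𝔼 => deriv P (‖z‖ ^ 2)) := hPd.comp (contDiff_norm_sq ℝ)
  have hψc : ContDiff ℝ ∞ (fun z : 𝔼 => (1 / 2) * P (‖z‖ ^ 2)) :=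
    contDiff_const.mul (hPc.comp (contDiff_norm_sq ℝ))
  have hψd : ∀ v : 𝔼, dirDeriv v (fun z : 𝔼 => (1 / 2) * P (‖z‖ ^ 2)) =
      fun z => deriv P (‖z‖ ^ 2) * inner ℝ z v := by
    intro v
    ext z
    have h1 : HasFDerivAt (fun z : 𝔼 => ‖z‖ ^ 2) (2 • innerSL ℝ z) z :=
      (hasStrictFDerivAt_norm_sq z).hasFDerivAt
    have h2 := (hPc.differentiable (by simp) (‖z‖ ^ 2)).hasDerivAt.comp_hasFDerivAt z h1
    have h3 := (h2.const_mul (1 / 2)).fderiv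
    simp only [_root_.dirDeriv]
    have h4 : (fun z : 𝔼 => 1 / 2 * P (‖z‖ ^ 2)) =
      fun y => 1 / 2 * (P ∘ fun z : 𝔼 => ‖z‖ ^ 2) y := rfl
    rw [h4, h3]
    simp
    ring
  have hφs := hsupp (fun z : 𝔼 => deriv P (‖z‖ ^ 2)) fun z hz => hd0 _ hz
  refine ⟨fun z => deriv P (‖z‖ ^ 2), fun z => (1 / 2) * P (‖z‖ ^ 2),
    ⟨hφc, hψc, hφs, hsupp _ fun z hz => by rw [hP0 _ hz.le, mul_zero], fun z => ?_⟩, ?_⟩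
  · rw [laplacian_eq_sum_dirDeriv hψc]
    simp only [hψd]
    set φ : 𝔼 → ℝ := fun z => deriv P (‖z‖ ^ 2) with hφ
    have h1 : ∀ i, dirDeriv (EuclideanSpace.basisFun (Fin n) ℝ i)
        (fun z : 𝔼 => φ z * inner ℝ z (EuclideanSpace.basisFun (Fin n) ℝ i)) z =
        φ z + z i * fderiv ℝ φ z (EuclideanSpace.basisFun (Fin n) ℝ i) := by
      intro i
      have h2 : HasFDerivAt (fun z : 𝔼 => z i) (EuclideanSpace.proj i : 𝔼 →L[ℝ] ℝ) z :=
        (EuclideanSpace.proj i : 𝔼 →L[ℝ] ℝ).hasFDerivAt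
      have h3 := ((hφc.differentiable (by simp) z).hasFDerivAt.mul h2).fderiv
      have h4 : (fun z : 𝔼 => φ z * inner ℝ z (EuclideanSpace.basisFun (Fin n) ℝ i)) =
          fun z => φ z * z i := by
        ext z
        simp [EuclideanSpace.inner_single_right]
      simp only [_root_.dirDeriv, h4]
      erw [h3]
      simp [hφ]
    have h5 : fderiv ℝ φ z z =
        ∑ i, z i * fderiv ℝ φ z (EuclideanSpace.basisFun (Fin n) ℝ i) := by
      conv_lhs => rw [← (EuclideanSpace.basisFun (Fin n) ℝ).sum_repr z]
      rw [(EuclideanSpace.basisFun (Fin n) ℝ).sum_repr z]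
      conv_lhs => arg 2; rw [← (EuclideanSpace.basisFun (Fin n) ℝ).sum_repr z]
      rw [map_sum]
      simp
    rw [Finset.sum_congr rfl fun i _ => h1 i, Finset.sum_add_distrib, h5]
    simp [hφ]
  · have hcs : HasCompactSupport (fun z : 𝔼 => deriv P (‖z‖ ^ 2)) :=
      hasCompactSupport_of_tsupport_subset_ball hφs
    -- `P` rises from a negative value at `0` to `0` at `1`, so its derivative is nonzero somewhere
    -- in between.
    obtain ⟨s, hs0, hs1, hs⟩ : ∃ s, 0 < s ∧ s < 1 ∧ deriv P s ≠ 0 := by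
      obtain ⟨s, hs, h⟩ := exists_deriv_eq_slope P (zero_lt_one' ℝ) hPc.continuous.continuousOn
        (hPc.differentiable (by simp)).differentiableOn
      refine ⟨s, hs.1, hs.2, ?_⟩
      have h1 : P 1 = 0 := hP0 1 (by norm_num)
      have h2 : P 0 < 0 := by
        simp only [hP, neg_lt_zero]
        exact expNegInvGlue.pos_of_pos (by norm_num)
      rw [h, h1]
      simp [h2.ne]
    have : Nonempty (Fin n) := Fin.pos_iff_nonempty.1 (Nat.pos_of_ne_zero hn)
    obtain ⟨z, hz⟩ : ∃ z : 𝔼, ‖z‖ = √s := by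
      refine ⟨EuclideanSpace.single (Classical.arbitrary (Fin n)) √s, ?_⟩
      simp
    refine Continuous.integral_pos_of_hasCompactSupport_nonneg_nonzero (x := z) hφc.continuous hcs
      (fun y => hmono.deriv_nonneg) ?_
    rw [hz, Real.sq_sqrt hs0.le]
    exact hs

end Laplacian

/-! ### Rescaled kernels and their derivatives in scale and position -/

section Mollification

variable {n : ℕ}

local notation "𝔼" => EuclideanSpace ℝ (Fin n)

theorem integral_comp_inv_smul_sub (h : 𝔼 → ℝ) {t : ℝ} (ht : 0 < t) (x : 𝔼) :
    ∫ y, h (t⁻¹ • (x - y)) = t ^ n * ∫ z, h z := by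
  rw [integral_sub_left_eq_self (fun y => h (t⁻¹ • y)) volume x,
    Measure.integral_comp_inv_smul_of_nonneg volume h ht.le]
  simp

theorem integrable_comp_inv_smul_sub {h : 𝔼 → ℝ} (hh : Integrable h) {t : ℝ} (ht : 0 < t)
    (x : 𝔼) : Integrable fun y => h (t⁻¹ • (x - y)) :=
  (hh.comp_smul (inv_ne_zero ht.ne')).comp_sub_left x

theorem integrable_of_tsupport_subset_ball {K : 𝔼 → ℝ} {r : ℝ} (hc : Continuous K)
    (hK : tsupport K ⊆ ball 0 r) : Integrable K :=
  hc.integrable_of_hasCompactSupport (hasCompactSupport_of_tsupport_subset_ball hK)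

theorem exists_bound_of_tsupport_subset_ball {K : 𝔼 → ℝ} {r : ℝ} (hc : Continuous K)
    (hK : tsupport K ⊆ ball 0 r) : ∃ M, ∀ z, ‖K z‖ ≤ M :=
  hc.bounded_above_of_compact_support (hasCompactSupport_of_tsupport_subset_ball hK)

theorem comp_inv_smul_sub_eq_zero {K : 𝔼 → ℝ} {r : ℝ} (hK : tsupport K ⊆ ball 0 r) {t : ℝ}
    (ht : 0 < t) {x y : 𝔼} (hy : y ∉ ball x (t * r)) : K (t⁻¹ • (x - y)) = 0 := by
  refine image_eq_zero_of_notMem_tsupport fun h => hy ?_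
  have h1 := hK h
  rw [mem_ball_zero_iff, norm_smul, norm_inv, Real.norm_of_nonneg ht.le,
    inv_mul_lt_iff₀ ht] at h1
  rwa [mem_ball, dist_comm, dist_eq_norm]

/-- A rescaled kernel only sees the values near its centre. -/
theorem abs_integral_mul_kernel_le {K : 𝔼 → ℝ} {r : ℝ} (hc : Continuous K)
    (hK : tsupport K ⊆ ball 0 r) {t M : ℝ} (ht : 0 < t) {x : 𝔼} {F : 𝔼 → ℝ}
    (hF : ∀ y ∈ ball x (t * r), |F y| ≤ M) :
    |∫ y, F y * K (t⁻¹ • (x - y))| ≤ M * (t ^ n * ∫ z, |K z|) := by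
  have hi := (integrable_comp_inv_smul_sub
    (integrable_of_tsupport_subset_ball hc hK).abs ht x).const_mul M
  have h1 := norm_integral_le_of_norm_le (f := fun y => F y * K (t⁻¹ • (x - y))) hi
    (.of_forall fun y => ?_)
  · rwa [integral_const_mul, integral_comp_inv_smul_sub (fun z => |K z|) ht] at h1
  · rw [norm_mul, Real.norm_eq_abs, Real.norm_eq_abs]
    by_cases hy : y ∈ ball x (t * r)
    · exact mul_le_mul_of_nonneg_right (hF y hy) (abs_nonneg _)
    · rw [comp_inv_smul_sub_eq_zero hK ht hy]
      simp

/-- The mollification `t ^ (-(n + m)) ∫ U(y) K((x - y) / t) dy`. -/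
noncomputable def kernelMean (m : ℕ) (K U : 𝔼 → ℝ) (t : ℝ) (x : 𝔼) : ℝ :=
  ∫ y, U y * (t ^ (-((n : ℤ) + m)) * K (t⁻¹ • (x - y)))

theorem kernelMean_eq (m : ℕ) (K U : 𝔼 → ℝ) (t : ℝ) (x : 𝔼) :
    kernelMean m K U t x = t ^ (-((n : ℤ) + m)) * ∫ y, U y * K (t⁻¹ • (x - y)) := by
  rw [kernelMean, ← integral_const_mul]
  congr 1
  ext y
  ring

theorem hasDerivAt_integral_mul {U : 𝔼 → ℝ} (hU : Integrable U) {k k' : ℝ → 𝔼 → ℝ} {θ M M' : ℝ}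
    {s : Set ℝ} (hs : s ∈ 𝓝 θ) (hk : ∀ θ ∈ s, ∀ y, HasDerivAt (fun θ => k θ y) (k' θ y) θ)
    (hM' : ∀ θ ∈ s, ∀ y, ‖k' θ y‖ ≤ M') (hM : ∀ y, ‖k θ y‖ ≤ M)
    (hc : ∀ θ, Continuous (k θ)) (hc' : Continuous (k' θ)) :
    HasDerivAt (fun θ => ∫ y, U y * k θ y) (∫ y, U y * k' θ y) θ := by
  refine (hasDerivAt_integral_of_dominated_loc_of_deriv_le (μ := volume)
    (F := fun θ y => U y * k θ y) (F' := fun θ y => U y * k' θ y)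
    (bound := fun y => ‖U y‖ * M') hs
    (.of_forall fun θ => hU.aestronglyMeasurable.mul (hc θ).aestronglyMeasurable)
    (hU.mul_bdd (c := M) (hc θ).aestronglyMeasurable (.of_forall hM))
    (hU.aestronglyMeasurable.mul hc'.aestronglyMeasurable) (.of_forall fun y τ hτ => ?_)
    (hU.norm.mul_const M') (.of_forall fun y τ hτ => (hk τ hτ y).const_mul (U y))).2
  rw [norm_mul]
  exact mul_le_mul_of_nonneg_left (hM' τ hτ y) (norm_nonneg _)

theorem IsKernelPair.hasDerivAt_kernel {m : ℕ} {K L : 𝔼 → ℝ} (h : IsKernelPair m K L) {t : ℝ}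
    (ht : 0 < t) (z : 𝔼) :
    HasDerivAt (fun t : ℝ => t ^ (-((n : ℤ) + m)) * K (t⁻¹ • z))
      (-(t ^ (-((n : ℤ) + m) - 1) * Laplacian.laplacian L (t⁻¹ • z))) t := by
  have h1 := hasDerivAt_zpow (-((n : ℤ) + m)) t (Or.inl ht.ne')
  have h2 : HasDerivAt (fun t : ℝ => t⁻¹ • z) ((-(t ^ 2)⁻¹) • z) t :=
    (hasDerivAt_inv ht.ne').smul_const z
  have h3 := (h.contDiff_fst.differentiable (by simp) (t⁻¹ • z)).hasFDerivAt.comp_hasDerivAt t h2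
  refine (h1.mul h3).congr_deriv ?_
  rw [← h.euler, map_smul, map_smul]
  have h4 : t ^ (-((n : ℤ) + m)) = t ^ (-((n : ℤ) + m) - 1) * t := by
    rw [← zpow_add_one₀ ht.ne']
    simp
  simp only [smul_eq_mul, Function.comp_apply]
  rw [h4]
  push_cast
  field_simp
  ring

/-- The Euler relation of the pair, differentiated under the integral: the change in scale is a
Laplacian tested against `U`. -/
theorem IsKernelPair.hasDerivAt_kernelMean {m : ℕ} {K L : 𝔼 → ℝ} (h : IsKernelPair m K L)
    {U : 𝔼 → ℝ} (hU : Integrable U) {t : ℝ} (ht : 0 < t) (x : 𝔼) :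
    HasDerivAt (fun t => kernelMean m K U t x)
      (-(t ^ (-((n : ℤ) + m) - 1) * ∫ y, U y * Laplacian.laplacian L (t⁻¹ • (x - y)))) t := by
  have hΔ := h.contDiff_snd.laplacian_smooth.continuous
  obtain ⟨M, hM⟩ := exists_bound_of_tsupport_subset_ball h.contDiff_fst.continuous h.tsupport_fst
  obtain ⟨M', hM'⟩ : ∃ M, ∀ z, ‖Laplacian.laplacian L z‖ ≤ M := by
    refine hΔ.bounded_above_of_compact_support (HasCompactSupport.of_support_subset_isCompact
      (hasCompactSupport_of_tsupport_subset_ball h.tsupport_snd) fun z hz => ?_)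
    by_contra hz'
    exact hz (laplacian_eq_zero_of_notMem_tsupport h.contDiff_snd hz')
  have hcont : ∀ θ : ℝ, Continuous fun y : 𝔼 => θ⁻¹ • (x - y) := fun θ => by fun_prop
  have hct : ContinuousAt (fun θ : ℝ => ‖θ ^ (-((n : ℤ) + m) - 1)‖) t :=
    (continuousAt_zpow₀ t _ (Or.inl ht.ne')).norm
  -- The power of `θ` blows up at `0`, so domination is arranged on a neighbourhood of `t` where it
  -- exceeds its value at `t` by less than `1`.
  have hs : {θ : ℝ | 0 < θ ∧ ‖θ ^ (-((n : ℤ) + m) - 1)‖ < ‖t ^ (-((n : ℤ) + m) - 1)‖ + 1} ∈ 𝓝 t :=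
    (eventually_gt_nhds ht).and (hct.eventually_lt_const (lt_add_one _))
  have hM0 : 0 ≤ M' := (norm_nonneg _).trans (hM' 0)
  have key := hasDerivAt_integral_mul hU
    (k := fun θ y => θ ^ (-((n : ℤ) + m)) * K (θ⁻¹ • (x - y)))
    (k' := fun θ y => -(θ ^ (-((n : ℤ) + m) - 1) * Laplacian.laplacian L (θ⁻¹ • (x - y))))
    (M := ‖t ^ (-((n : ℤ) + m))‖ * M) (M' := (‖t ^ (-((n : ℤ) + m) - 1)‖ + 1) * M')
    hs (fun θ hθ y => h.hasDerivAt_kernel hθ.1 (x - y)) (fun θ hθ y => ?_) (fun y => ?_)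
    (fun θ => continuous_const.mul (h.contDiff_fst.continuous.comp (hcont θ)))
    (continuous_const.mul (hΔ.comp (hcont t))).neg
  · refine key.congr_deriv ?_
    rw [← integral_const_mul, ← integral_neg]
    congr 1
    ext y
    ring
  · rw [norm_neg, norm_mul]
    exact mul_le_mul hθ.2.le (hM' _) (norm_nonneg _) (by positivity)
  · rw [norm_mul]
    exact mul_le_mul_of_nonneg_left (hM _) (norm_nonneg _)

/-- A spatial derivative falls on the kernel and produces a factor `t⁻¹`, which the normalisation
absorbs by passing to `m + 1`. -/
theorem hasDerivAt_kernelMean_line {m : ℕ} {K : 𝔼 → ℝ} {r : ℝ} (hK : ContDiff ℝ ∞ K)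
    (hKs : tsupport K ⊆ ball 0 r) {U : 𝔼 → ℝ} (hU : Integrable U) {t : ℝ} (ht : 0 < t)
    (x w : 𝔼) (s : ℝ) :
    HasDerivAt (fun s : ℝ => kernelMean m K U t (x + s • w))
      (kernelMean (m + 1) (dirDeriv w K) U t (x + s • w)) s := by
  obtain ⟨M, hM⟩ := exists_bound_of_tsupport_subset_ball hK.continuous hKs
  obtain ⟨M', hM'⟩ := exists_bound_of_tsupport_subset_ball (hK.dirDeriv w).continuous
    ((tsupport_dirDeriv_subset _ _).trans hKs)
  have hcont : ∀ s : ℝ, Continuous fun y : 𝔼 => t⁻¹ • (x + s • w - y) := fun s => by fun_prop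
  have h4 : t ^ (-((n : ℤ) + m)) * t⁻¹ = t ^ (-((n : ℤ) + (m + 1 : ℕ))) := by
    rw [← zpow_sub_one₀ ht.ne']
    congr 1
    push_cast
    ring
  refine hasDerivAt_integral_mul hU
    (k := fun s y => t ^ (-((n : ℤ) + m)) * K (t⁻¹ • (x + s • w - y)))
    (k' := fun s y => t ^ (-((n : ℤ) + (m + 1 : ℕ))) * dirDeriv w K (t⁻¹ • (x + s • w - y)))
    (M := ‖t ^ (-((n : ℤ) + m))‖ * M)
    (M' := ‖t ^ (-((n : ℤ) + (m + 1 : ℕ)))‖ * M') univ_mem (fun s _ y => ?_) (fun s _ y => ?_)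
    (fun y => ?_) (fun s => continuous_const.mul (hK.continuous.comp (hcont s)))
    (continuous_const.mul ((hK.dirDeriv w).continuous.comp (hcont s)))
  · have h2 : HasDerivAt (fun s : ℝ => t⁻¹ • (x + s • w - y)) (t⁻¹ • (1 : ℝ) • w) s :=
      ((((hasDerivAt_id s).smul_const w).const_add x).sub_const y).const_smul t⁻¹
    have h3 := (hK.differentiable (by simp)
      (t⁻¹ • (x + s • w - y))).hasFDerivAt.comp_hasDerivAt s h2
    refine (h3.const_mul _).congr_deriv ?_
    rw [← h4, one_smul, map_smul, smul_eq_mul, ← mul_assoc]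
    rfl
  · rw [norm_mul]
    exact mul_le_mul_of_nonneg_left (hM' _) (norm_nonneg _)
  · rw [norm_mul]
    exact mul_le_mul_of_nonneg_left (hM _) (norm_nonneg _)

theorem integral_dirDeriv_eq_zero {φ : 𝔼 → ℝ} {r : ℝ} (hφ : ContDiff ℝ ∞ φ)
    (hφs : tsupport φ ⊆ ball 0 r) (v : 𝔼) : ∫ z, dirDeriv v φ z = 0 := by
  have h := integral_mul_fderiv_eq_neg_fderiv_mul_of_integrable (𝕜 := ℝ) (μ := volume)
    (f := fun _ : 𝔼 => (1 : ℝ)) (g := φ) (v := v) (by simp)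
    (by
      simp only [one_mul]
      exact integrable_of_tsupport_subset_ball (hφ.dirDeriv v).continuous
        ((tsupport_dirDeriv_subset _ _).trans hφs))
    (by simpa using integrable_of_tsupport_subset_ball hφ.continuous hφs)
    (by simp) (fun x _ => hφ.differentiable (by simp) x)
  simpa [dirDeriv] using h

theorem integral_clm_mul_dirDeriv {φ : 𝔼 → ℝ} {r : ℝ} (hφ : ContDiff ℝ ∞ φ)
    (hφs : tsupport φ ⊆ ball 0 r) (A : 𝔼 →L[ℝ] ℝ) (v : 𝔼) :
    ∫ z, A z * dirDeriv v φ z = -(A v * ∫ z, φ z) := by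
  have hi : ∀ {g h : 𝔼 → ℝ}, Continuous g → Continuous h → tsupport h ⊆ ball 0 r →
      Integrable fun z => g z * h z := fun hg hh hs =>
    (hg.mul hh).integrable_of_hasCompactSupport
      (hasCompactSupport_of_tsupport_subset_ball hs).mul_left
  have h := integral_mul_fderiv_eq_neg_fderiv_mul_of_integrable (𝕜 := ℝ) (μ := volume)
    (f := A) (g := φ) (v := v)
    (by simpa using (integrable_of_tsupport_subset_ball hφ.continuous hφs).const_mul (A v))
    (hi A.continuous (hφ.dirDeriv v).continuous ((tsupport_dirDeriv_subset _ _).trans hφs))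
    (hi A.continuous hφ.continuous hφs)
    (fun x _ => A.differentiableAt) (fun x _ => hφ.differentiable (by simp) x)
  simp only [ContinuousLinearMap.fderiv, integral_const_mul] at h
  exact h

/-- Mollifying against `∂ᵥφ` recovers the directional derivative as `t → 0`. -/
theorem tendsto_kernelMean_dirDeriv {φ : 𝔼 → ℝ} {r : ℝ} (hφ : ContDiff ℝ ∞ φ) (hr : r ≤ 1)
    (hφs : tsupport φ ⊆ ball 0 r) {U : 𝔼 → ℝ} (hU : Integrable U) {x : 𝔼} {A : 𝔼 →L[ℝ] ℝ}
    (hA : HasFDerivAt U A x) (v : 𝔼) :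
    Tendsto (fun t => kernelMean 1 (dirDeriv v φ) U t x) (𝓝[>] 0) (𝓝 (A v * ∫ z, φ z)) := by
  set K := dirDeriv v φ with hKdef
  have hK : Continuous K := (hφ.dirDeriv v).continuous
  have hKs : tsupport K ⊆ ball 0 r := (tsupport_dirDeriv_subset _ _).trans hφs
  have hKi := integrable_of_tsupport_subset_ball hK hKs
  obtain ⟨M, hM⟩ := exists_bound_of_tsupport_subset_ball hK hKs
  set I := ∫ z, |K z| with hI
  have hI0 : 0 ≤ I := integral_nonneg fun z => abs_nonneg _
  rw [Metric.tendsto_nhds]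
  intro ε hε
  have hδ : 0 < ε / (I + 1) := by positivity
  have h1 := hA.isLittleO.def hδ
  obtain ⟨ρ, hρ, h2⟩ := Metric.eventually_nhds_iff_ball.1 h1
  filter_upwards [Ioo_mem_nhdsGT hρ] with t ht
  have ht0 : 0 < t := ht.1
  have h3 : |∫ y, (U y - U x - A (y - x)) * K (t⁻¹ • (x - y))| ≤
      (ε / (I + 1) * t) * (t ^ n * I) := by
    refine abs_integral_mul_kernel_le hK hKs ht0 fun y hy => ?_
    have hyt : dist y x < t := (mem_ball.1 hy).trans_le (mul_le_of_le_one_right ht0.le hr)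
    refine (h2 y (mem_ball.2 (hyt.trans ht.2))).trans ?_
    rw [← dist_eq_norm]
    exact mul_le_mul_of_nonneg_left hyt.le hδ.le
  -- Separates the first-order Taylor polynomial: the constant term vanishes because `∂ᵥφ` has mean
  -- zero, and the linear term gives `A v ∫ φ` by parts, the two minus signs cancelling.
  have h4 : (fun y => (U y - U x - A (y - x)) * K (t⁻¹ • (x - y))) = fun y =>
      U y * K (t⁻¹ • (x - y)) - U x * K (t⁻¹ • (x - y)) +
        t * (A (t⁻¹ • (x - y)) * K (t⁻¹ • (x - y))) := by
    ext y
    have : A (t⁻¹ • (x - y)) = -(t⁻¹ * A (y - x)) := by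
      rw [map_smul, ← neg_sub y x, map_neg, smul_neg, smul_eq_mul]
    rw [this]
    field_simp
    ring
  have hAK : Integrable fun z => A z * K z :=
    (A.continuous.mul hK).integrable_of_hasCompactSupport
      (hasCompactSupport_of_tsupport_subset_ball hKs).mul_left
  have hi1 : Integrable fun y => U y * K (t⁻¹ • (x - y)) :=
    hU.mul_bdd (c := M) (hK.comp (by fun_prop : Continuous fun y : 𝔼 =>
      t⁻¹ • (x - y))).aestronglyMeasurable (.of_forall fun y => hM _)
  have hi2 := (integrable_comp_inv_smul_sub hKi ht0 x).const_mul (U x)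
  have hi3 := (integrable_comp_inv_smul_sub hAK ht0 x).const_mul t
  have hi12 : Integrable fun y => U y * K (t⁻¹ • (x - y)) - U x * K (t⁻¹ • (x - y)) := hi1.sub hi2
  rw [h4, integral_add hi12 hi3, integral_sub hi1 hi2, integral_const_mul,
    integral_const_mul, integral_comp_inv_smul_sub K ht0,
    integral_comp_inv_smul_sub (fun z => A z * K z) ht0, hKdef,
    integral_dirDeriv_eq_zero hφ hφs, integral_clm_mul_dirDeriv hφ hφs, ← hKdef] at h3
  have hz : t ^ (-((n : ℤ) + (1 : ℕ))) = (t ^ (n + 1))⁻¹ := by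
    rw [zpow_neg]
    congr 1
  rw [kernelMean_eq, Real.dist_eq, hz]
  have h5 : (t ^ (n + 1))⁻¹ * (∫ y, U y * K (t⁻¹ • (x - y))) - A v * ∫ z, φ z =
      (t ^ (n + 1))⁻¹ * ((∫ y, U y * K (t⁻¹ • (x - y))) - U x * (t ^ n * 0) +
        t * (t ^ n * -(A v * ∫ z, φ z))) := by
    field_simp
    ring
  rw [h5, abs_mul, abs_of_pos (by positivity : 0 < (t ^ (n + 1))⁻¹), inv_mul_lt_iff₀ (by positivity)]
  refine h3.trans_lt ?_
  have h6 : ε / (I + 1) * t * (t ^ n * I) = t ^ (n + 1) * (ε * (I / (I + 1))) := by ring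
  rw [h6]
  refine mul_lt_mul_of_pos_left ?_ (by positivity)
  refine mul_lt_of_lt_one_right hε ?_
  rw [div_lt_one (by positivity)]
  linarith

/-- The kernel form of the Poisson equation, after cutting both sides off to a closed ball. -/
theorem IsWeakPoissonSolution.integral_mul_laplacian_kernel {u f L : 𝔼 → ℝ}
    (h : IsWeakPoissonSolution (ball 0 1) u f) (hL : ContDiff ℝ ∞ L)
    (hLs : tsupport L ⊆ ball 0 (1 / 4)) {x : 𝔼} (hx : x ∈ ball (0 : 𝔼) (1 / 2)) {t : ℝ}
    (ht : 0 < t) (ht1 : t ≤ 1) :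
    ∫ y, (closedBall 0 (3 / 4)).indicator u y * Laplacian.laplacian L (t⁻¹ • (x - y)) =
      t ^ 2 * ∫ y, (closedBall 0 (3 / 4)).indicator f y * L (t⁻¹ • (x - y)) := by
  set g : 𝔼 → ℝ := fun y => L (t⁻¹ • (x - y)) with hg
  have hgc : ContDiff ℝ ∞ g := hL.comp ((contDiff_const.sub contDiff_id).const_smul _)
  have hsub : closedBall x (t * (1 / 4)) ⊆ closedBall 0 (3 / 4) := by
    refine closedBall_subset_closedBall' ?_
    have := mem_ball.1 hx
    linarith
  have hgs : tsupport g ⊆ closedBall 0 (3 / 4) := by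
    refine closure_minimal (fun y hy => ?_) isClosed_closedBall
    by_contra hy'
    exact hy (comp_inv_smul_sub_eq_zero hLs ht fun h => hy' (hsub (ball_subset_closedBall h)))
  have hsub1 : closedBall (0 : 𝔼) (3 / 4) ⊆ ball 0 1 := closedBall_subset_ball (by norm_num)
  have hw := h g hgc ((isCompact_closedBall (0 : 𝔼) (3 / 4)).of_isClosed_subset
    (isClosed_tsupport g) hgs) (hgs.trans hsub1)
  have hind : ∀ a b : 𝔼 → ℝ, (∀ y ∉ closedBall (0 : 𝔼) (3 / 4), b y = 0) →
      ∫ y in ball 0 1, a y * b y = ∫ y, (closedBall 0 (3 / 4)).indicator a y * b y := by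
    intro a b hb
    rw [← integral_indicator measurableSet_ball]
    congr 1
    ext y
    by_cases hy : y ∈ closedBall (0 : 𝔼) (3 / 4)
    · rw [indicator_of_mem hy, indicator_of_mem (hsub1 hy)]
    · rw [indicator_of_notMem hy, zero_mul]
      by_cases hy1 : y ∈ ball (0 : 𝔼) 1
      · rw [indicator_of_mem hy1, hb y hy, mul_zero]
      · rw [indicator_of_notMem hy1]
  rw [hind u _ fun y hy => laplacian_eq_zero_of_notMem_tsupport hgc fun h => hy (hgs h),
    hind f g fun y hy => image_eq_zero_of_notMem_tsupport fun h => hy (hgs h)] at hw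
  rw [← hw, hg, laplacian_comp_smul_sub hL, ← integral_const_mul]
  congr 1
  ext y
  field_simp

end Mollification

/-! ### Kernel norms, uniform in the directions -/

section Integrals

variable {E : Type*} [NormedAddCommGroup E] [NormedSpace ℝ E] [MeasurableSpace E] [BorelSpace E]
  {μ : Measure E} [IsFiniteMeasureOnCompacts μ]

theorem integral_abs_dirDeriv_le {g : E → ℝ} (hg : ContDiff ℝ ∞ g) (hs : HasCompactSupport g)
    (v : E) : ∫ z, |dirDeriv v g z| ∂μ ≤ ‖v‖ * ∫ z, ‖fderiv ℝ g z‖ ∂μ := by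
  rw [← integral_const_mul]
  have hi : Integrable (fun z => ‖fderiv ℝ g z‖) μ :=
    (hg.continuous_fderiv (by simp)).norm.integrable_of_hasCompactSupport (hs.fderiv ℝ).norm
  have hi' : Integrable (fun z => |dirDeriv v g z|) μ :=
    (hg.dirDeriv v).continuous.abs.integrable_of_hasCompactSupport (hs.fderiv_apply ℝ v).abs
  refine integral_mono hi' (hi.const_mul _) fun z => ?_
  rw [mul_comm]
  exact (fderiv ℝ g z).le_opNorm v

theorem integral_abs_dirDeriv_dirDeriv_le {g : E → ℝ} (hg : ContDiff ℝ ∞ g)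
    (hs : HasCompactSupport g) (v w : E) :
    ∫ z, |dirDeriv w (dirDeriv v g) z| ∂μ ≤
      ‖v‖ * ‖w‖ * ∫ z, ‖iteratedFDeriv ℝ 2 g z‖ ∂μ := by
  rw [← integral_const_mul]
  have hi : Integrable (fun z => ‖iteratedFDeriv ℝ 2 g z‖) μ :=
    (ContDiff.continuous_iteratedFDeriv' (contDiff_infty.1 hg 2)).norm.integrable_of_hasCompactSupport
      (hs.iteratedFDeriv 2).norm
  have hi' : Integrable (fun z => |dirDeriv w (dirDeriv v g) z|) μ :=
    ((hg.dirDeriv v).dirDeriv w).continuous.abs.integrable_of_hasCompactSupport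
      ((hs.fderiv_apply ℝ v).fderiv_apply ℝ w).abs
  refine integral_mono hi' (hi.const_mul _) fun z => ?_
  simp only
  have h1 : dirDeriv w (dirDeriv v g) z = iteratedFDeriv ℝ 2 g z ![w, v] := by
    rw [dirDeriv_dirDeriv hg, iteratedFDeriv_two_apply]
    simp
  rw [h1]
  refine ((iteratedFDeriv ℝ 2 g z).le_opNorm ![w, v]).trans_eq ?_
  simp only [Fin.prod_univ_two, Matrix.cons_val_zero, Matrix.cons_val_one]
  ring

end Integrals

/-! ### Gradient estimates -/

section Estimates

variable {n : ℕ}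

local notation "𝔼" => EuclideanSpace ℝ (Fin n)

/-- The cut-off of `g` to the closed ball of radius `3/4`. -/
noncomputable def truncate (g : 𝔼 → ℝ) : 𝔼 → ℝ := (closedBall 0 (3 / 4)).indicator g

theorem integrable_truncate {g : 𝔼 → ℝ} (hg : ContinuousOn g (ball 0 1)) :
    Integrable (truncate g) :=
  ((hg.mono (closedBall_subset_ball (by norm_num))).integrableOn_compact
    (isCompact_closedBall _ _)).integrable_indicator measurableSet_closedBall

theorem truncate_eq {g : 𝔼 → ℝ} {x y : 𝔼} (hx : x ∈ ball (0 : 𝔼) (1 / 2))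
    (hy : y ∈ ball x (1 / 4)) : truncate g y = g y := by
  refine indicator_of_mem ?_ g
  have := mem_ball.1 hx
  have h1 := mem_ball.1 hy
  have h2 := dist_triangle y x 0
  rw [mem_closedBall]
  linarith

/-- The equation turns the scale derivative into an integral of `f`. The bound `M` is left free: it
will be `sup |f|` for `m = 1`, and the modulus of `f` at `t` for `m = 2`. -/
theorem IsKernelPair.exists_hasDerivAt_kernelMean_truncate {m : ℕ} {K L : 𝔼 → ℝ}
    (h : IsKernelPair m K L) {u f : 𝔼 → ℝ} (hu : ContinuousOn u (ball 0 1))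
    (hw : IsWeakPoissonSolution (ball 0 1) u f) {x : 𝔼} (hx : x ∈ ball (0 : 𝔼) (1 / 2))
    {t M : ℝ} (ht : 0 < t) (ht1 : t ≤ 1)
    (hM : |∫ y, truncate f y * L (t⁻¹ • (x - y))| ≤ M * (t ^ n * ∫ z, |L z|)) :
    ∃ D, HasDerivAt (fun t => kernelMean m K (truncate u) t x) D t ∧
      |D| ≤ t ^ (1 - (m : ℤ)) * (M * ∫ z, |L z|) := by
  refine ⟨_, h.hasDerivAt_kernelMean (integrable_truncate hu) ht x, ?_⟩
  have h1 := hw.integral_mul_laplacian_kernel h.contDiff_snd h.tsupport_snd hx ht ht1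
  unfold truncate at hM ⊢
  rw [h1, abs_neg, abs_mul, abs_mul, abs_of_pos (zpow_pos ht _), abs_of_pos (pow_pos ht 2)]
  have h2 : t ^ (1 - (m : ℤ)) = t ^ (-((n : ℤ) + m) - 1) * (t ^ 2 * t ^ n) := by
    rw [← zpow_natCast t 2, ← zpow_natCast t n, ← zpow_add₀ ht.ne', ← zpow_add₀ ht.ne']
    congr 1
    push_cast
    ring
  calc t ^ (-((n : ℤ) + m) - 1) * (t ^ 2 * _)
      ≤ t ^ (-((n : ℤ) + m) - 1) * (t ^ 2 * (M * (t ^ n * ∫ z, |L z|))) := by gcongr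
    _ = _ := by rw [h2]; ring

theorem abs_integral_truncate_mul_le {K f : 𝔼 → ℝ} (hc : Continuous K)
    (hK : tsupport K ⊆ ball 0 (1 / 4)) {S : Set 𝔼} {x : 𝔼} (hx : x ∈ ball (0 : 𝔼) (1 / 2))
    (hxS : ball x (1 / 4) ⊆ S) {t M : ℝ} (ht : 0 < t) (ht1 : t ≤ 1) (hM : ∀ z ∈ S, |f z| ≤ M) :
    |∫ y, truncate f y * K (t⁻¹ • (x - y))| ≤ M * (t ^ n * ∫ z, |K z|) := by
  refine abs_integral_mul_kernel_le hc hK ht fun y hy => ?_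
  have hy' : y ∈ ball x (1 / 4) := ball_subset_ball (by linarith) hy
  rw [truncate_eq hx hy']
  exact hM y (hxS hy')

/-- The first-order mollification approximates the gradient to first order. -/
theorem abs_fderiv_sub_kernelMean_le {φ ψ : 𝔼 → ℝ} (h : IsKernelPair 0 φ ψ) {u f : 𝔼 → ℝ}
    (hu : ContDiffOn ℝ 1 u (ball 0 1)) (hw : IsWeakPoissonSolution (ball 0 1) u f)
    {S : Set 𝔼} {x : 𝔼} (hx : x ∈ ball (0 : 𝔼) (1 / 2)) (hxS : ball x (1 / 4) ⊆ S)
    {M : ℝ} (hM : ∀ z ∈ S, |f z| ≤ M) (v : 𝔼) {t : ℝ} (ht : 0 < t) (ht1 : t ≤ 1) :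
    |fderiv ℝ u x v * (∫ z, φ z) - kernelMean 1 (dirDeriv v φ) (truncate u) t x| ≤
      t * (M * ∫ z, |dirDeriv v ψ z|) := by
  have hp : IsKernelPair 1 (dirDeriv v φ) (dirDeriv v ψ) := by simpa using h.dirDeriv v
  set G := fun t => kernelMean 1 (dirDeriv v φ) (truncate u) t x with hG
  set B := M * ∫ z, |dirDeriv v ψ z| with hB
  have hM0 : 0 ≤ M := (abs_nonneg _).trans (hM x (hxS (mem_ball_self (by norm_num))))
  have hB0 : 0 ≤ B := mul_nonneg hM0 (integral_nonneg fun z => abs_nonneg _)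
  have hdiff : ∀ s ∈ Ioc (0 : ℝ) 1, ∃ D, HasDerivAt G D s ∧ |D| ≤ B := fun s hs => by
    obtain ⟨D, hD, hD'⟩ := hp.exists_hasDerivAt_kernelMean_truncate hu.continuousOn hw hx hs.1 hs.2
      (abs_integral_truncate_mul_le hp.contDiff_snd.continuous hp.tsupport_snd hx hxS hs.1 hs.2 hM)
    exact ⟨D, hD, by simpa using hD'⟩
  choose! D hD hDB using hdiff
  have hU : HasFDerivAt (truncate u) (fderiv ℝ u x) x := by
    have hx1 : ball (0 : 𝔼) 1 ∈ 𝓝 x := isOpen_ball.mem_nhds (ball_subset_ball (by norm_num) hx)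
    refine ((hu.contDiffAt hx1).differentiableAt (by simp)).hasFDerivAt.congr_of_eventuallyEq ?_
    filter_upwards [ball_mem_nhds x (by norm_num : (0 : ℝ) < 1 / 4)] with y hy
      using truncate_eq hx hy
  have hlim := tendsto_kernelMean_dirDeriv h.contDiff_fst (by norm_num) h.tsupport_fst
    (integrable_truncate hu.continuousOn) hU v
  -- The mean value inequality is applied on `[s, t]`, away from the singular scale `0`, and then `s
  -- → 0`.
  refine le_of_tendsto (hlim.sub_const (G t)).abs ?_
  filter_upwards [Ioo_mem_nhdsGT ht] with s hs
  have h1 := (convex_Icc s t).norm_image_sub_le_of_norm_hasDerivWithin_le (f := G) (f' := D)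
    (C := B) (fun r hr => (hD r ⟨hs.1.trans_le hr.1, hr.2.trans ht1⟩).hasDerivWithinAt)
    (fun r hr => hDB r ⟨hs.1.trans_le hr.1, hr.2.trans ht1⟩)
    (right_mem_Icc.2 hs.2.le) (left_mem_Icc.2 hs.2.le)
  refine h1.trans ?_
  rw [mul_comm, Real.norm_eq_abs, abs_of_neg (by linarith [hs.2])]
  exact mul_le_mul_of_nonneg_right (by linarith [hs.1]) hB0

/-- The second-order mollification grows at most like `∫ ω(r) / r dr`. -/
theorem abs_kernelMean_two_sub_le {K L : 𝔼 → ℝ} (h : IsKernelPair 2 K L)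
    (hL0 : ∫ z, L z = 0) {u f : 𝔼 → ℝ} (hu : ContinuousOn u (ball 0 1))
    (hf : ContinuousOn f (ball 0 1)) (hw : IsWeakPoissonSolution (ball 0 1) u f)
    {S : Set 𝔼} {x : 𝔼} (hx : x ∈ ball (0 : 𝔼) (1 / 2)) (hxS : ball x (1 / 4) ⊆ S)
    {M W : ℝ} (hM : ∀ z ∈ S, |f z| ≤ M) {d : ℝ} (hd : 0 < d) (hd1 : d ≤ 1) (hW0 : 0 ≤ W)
    (hW : ∫⁻ r in Ioc d 1, modulusOn S f r / ENNReal.ofReal r ≤ ENNReal.ofReal W) :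
    |kernelMean 2 K (truncate u) 1 x - kernelMean 2 K (truncate u) d x| ≤
      (∫ z, |L z|) * W := by
  set G := fun t => kernelMean 2 K (truncate u) t x with hG
  set I := ∫ z, |L z| with hI
  have hI0 : 0 ≤ I := integral_nonneg fun z => abs_nonneg _
  have hxx : x ∈ S := hxS (mem_ball_self (by norm_num))
  have hM0 : 0 ≤ M := (abs_nonneg _).trans (hM x hxx)
  have hLc := h.contDiff_snd.continuous
  have hLi := integrable_of_tsupport_subset_ball hLc h.tsupport_snd
  obtain ⟨B, hB⟩ := exists_bound_of_tsupport_subset_ball hLc h.tsupport_snd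
  -- This bound loses a logarithm; it serves only for differentiability and for integrability of the
  -- derivative on `[d, 1]`.
  have hcrude : ∀ s ∈ Ioc (0 : ℝ) 1, ∃ D, HasDerivAt G D s ∧ |D| ≤ s⁻¹ * (M * I) := fun s hs => by
    obtain ⟨D, hD, hD'⟩ := h.exists_hasDerivAt_kernelMean_truncate hu hw hx hs.1 hs.2
      (abs_integral_truncate_mul_le hLc h.tsupport_snd hx hxS hs.1 hs.2 hM)
    exact ⟨D, hD, by simpa [zpow_neg_one] using hD'⟩
  have hdG : ∀ s ∈ Ioc (0 : ℝ) 1, HasDerivAt G (deriv G s) s := fun s hs => by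
    obtain ⟨D, hD, -⟩ := hcrude s hs
    exact hD.differentiableAt.hasDerivAt
  have hcr : ∀ s ∈ Ioc (0 : ℝ) 1, |deriv G s| ≤ s⁻¹ * (M * I) := fun s hs => by
    obtain ⟨D, hD, hD'⟩ := hcrude s hs
    rwa [hD.deriv]
  have hmod : ∀ s, modulusOn S f s ≤ ENNReal.ofReal (2 * M) := fun s => by
    refine iSup₂_le fun a ha => iSup₂_le fun b hb => iSup_le fun _ => ?_
    rw [edist_dist, Real.dist_eq]
    refine ENNReal.ofReal_le_ofReal ((abs_sub _ _).trans ?_)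
    linarith [hM a ha, hM b hb]
  have hfine : ∀ s ∈ Ioc (0 : ℝ) 1,
      ‖deriv G s‖ₑ ≤ ENNReal.ofReal I * (modulusOn S f s / ENNReal.ofReal s) := by
    intro s hs
    have hne : modulusOn S f s ≠ ⊤ := ((hmod s).trans_lt ENNReal.ofReal_lt_top).ne
    set q := (modulusOn S f s).toReal with hq
    have hb : |∫ y, (truncate f y - f x) * L (s⁻¹ • (x - y))| ≤ q * (s ^ n * I) := by
      refine abs_integral_mul_kernel_le hLc h.tsupport_snd hs.1 fun y hy => ?_
      have hy' : y ∈ ball x (1 / 4) := ball_subset_ball (by linarith [hs.2]) hy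
      rw [truncate_eq hx hy', ← Real.dist_eq, ← ENNReal.ofReal_le_iff_le_toReal hne, ← edist_dist]
      have hys : dist y x < s := (mem_ball.1 hy).trans (by linarith [hs.1])
      exact le_iSup₂_of_le y (hxS hy') (le_iSup₂_of_le x hxx (le_iSup_of_le hys le_rfl))
    -- Subtracting `f x` is free since `L` has mean zero; this is where the oscillation of `f`
    -- replaces its size.
    have heq : ∫ y, (truncate f y - f x) * L (s⁻¹ • (x - y)) =
        ∫ y, truncate f y * L (s⁻¹ • (x - y)) := by
      have hi1 : Integrable fun y => truncate f y * L (s⁻¹ • (x - y)) :=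
        (integrable_truncate hf).mul_bdd (c := B) (hLc.comp (by fun_prop : Continuous fun y : 𝔼 =>
          s⁻¹ • (x - y))).aestronglyMeasurable (.of_forall fun y => hB _)
      have hi2 := (integrable_comp_inv_smul_sub hLi hs.1 x).const_mul (f x)
      simp only [sub_mul]
      rw [integral_sub hi1 hi2, integral_const_mul, integral_comp_inv_smul_sub L hs.1, hL0]
      simp
    rw [heq] at hb
    obtain ⟨D, hD, hD'⟩ := h.exists_hasDerivAt_kernelMean_truncate hu hw hx hs.1 hs.2 hb
    have h1 : |deriv G s| ≤ I * (q / s) := by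
      rw [hD.deriv]
      refine hD'.trans_eq ?_
      have : (1 - ((2 : ℕ) : ℤ)) = -1 := by norm_num
      rw [this, zpow_neg_one]
      ring
    rw [← ENNReal.ofReal_toReal hne, ← ENNReal.ofReal_div_of_pos hs.1, ← ENNReal.ofReal_mul hI0,
      Real.enorm_eq_ofReal_abs]
    exact ENNReal.ofReal_le_ofReal h1
  have hint : IntervalIntegrable (deriv G) volume d 1 := by
    rw [intervalIntegrable_iff_integrableOn_Ioc_of_le hd1]
    refine Measure.integrableOn_of_bounded (M := d⁻¹ * (M * I)) (by simp)
      (measurable_deriv G).aestronglyMeasurable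
      ((ae_restrict_mem measurableSet_Ioc).mono fun s hs => ?_)
    refine (hcr s ⟨hd.trans hs.1, hs.2⟩).trans ?_
    have := hs.1.le
    gcongr
  have hftc := intervalIntegral.integral_eq_sub_of_hasDerivAt (f := G) (f' := deriv G)
    (a := d) (b := 1) (fun s hs => by
      rw [uIcc_of_le hd1] at hs
      exact hdG s ⟨hd.trans_le hs.1, hs.2⟩) hint
  change |G 1 - G d| ≤ I * W
  rw [← hftc, intervalIntegral.integral_of_le hd1,
    ← ENNReal.ofReal_le_ofReal_iff (by positivity), ← Real.enorm_eq_ofReal_abs]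
  calc ‖∫ s in Ioc d 1, deriv G s‖ₑ ≤ ∫⁻ s in Ioc d 1, ‖deriv G s‖ₑ :=
        enorm_integral_le_lintegral_enorm _
    _ ≤ ∫⁻ s in Ioc d 1, ENNReal.ofReal I * (modulusOn S f s / ENNReal.ofReal s) :=
        setLIntegral_mono_ae' measurableSet_Ioc
          (.of_forall fun s hs => hfine s ⟨hd.trans hs.1, hs.2⟩)
    _ = ENNReal.ofReal I * ∫⁻ s in Ioc d 1, modulusOn S f s / ENNReal.ofReal s :=
        lintegral_const_mul' _ _ ENNReal.ofReal_ne_top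
    _ ≤ ENNReal.ofReal I * ENNReal.ofReal W := by gcongr
    _ = ENNReal.ofReal (I * W) := (ENNReal.ofReal_mul hI0).symm

/-- Both gradients are compared with their mollifications at scale `d = |x - y|`, which costs `2 *
Mf`. The mollifications are compared along the segment, where the second-order mean is bounded by
its value at scale `1` (the `Mu` term) plus its variation over scales (the `W` term). -/
theorem abs_fderiv_sub_fderiv_le {φ ψ : 𝔼 → ℝ} (h : IsKernelPair 0 φ ψ) (hφ : 0 < ∫ z, φ z)
    {u f : 𝔼 → ℝ} (hu : ContDiffOn ℝ 1 u (ball 0 1)) (hf : ContinuousOn f (ball 0 1))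
    (hw : IsWeakPoissonSolution (ball 0 1) u f) {S : Set 𝔼}
    (hS : ∀ x ∈ ball (0 : 𝔼) (1 / 2), ball x (1 / 4) ⊆ S) {x y : 𝔼}
    (hx : x ∈ ball (0 : 𝔼) (1 / 2)) (hy : y ∈ ball (0 : 𝔼) (1 / 2)) (hxy : x ≠ y)
    {Mu Mf W : ℝ} (hMu : ∀ z ∈ S, |u z| ≤ Mu) (hMf : ∀ z ∈ S, |f z| ≤ Mf) (hW0 : 0 ≤ W)
    (hW : ∫⁻ r in Ioc (dist x y) 1, modulusOn S f r / ENNReal.ofReal r ≤ ENNReal.ofReal W)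
    (v : 𝔼) :
    |fderiv ℝ u x v - fderiv ℝ u y v| * (∫ z, φ z) ≤
      ‖v‖ * dist x y * (2 * Mf * (∫ z, ‖fderiv ℝ ψ z‖) +
        Mu * (∫ z, ‖iteratedFDeriv ℝ 2 φ z‖) + W * ∫ z, ‖iteratedFDeriv ℝ 2 ψ z‖) := by
  set d := dist x y with hd
  have hd0 : 0 < d := dist_pos.2 hxy
  have hd1 : d ≤ 1 := by
    have h1 := dist_triangle_right x y 0
    have := mem_ball.1 hx
    have := mem_ball.1 hy
    linarith
  have hxx : x ∈ S := hS x hx (mem_ball_self (by norm_num))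
  have hMu0 : 0 ≤ Mu := (abs_nonneg _).trans (hMu x hxx)
  have hMf0 : 0 ≤ Mf := (abs_nonneg _).trans (hMf x hxx)
  have hI1 := integral_abs_dirDeriv_le (μ := volume) h.contDiff_snd
    (hasCompactSupport_of_tsupport_subset_ball h.tsupport_snd) v
  have hnear : ∀ z ∈ ball (0 : 𝔼) (1 / 2),
      |fderiv ℝ u z v * (∫ z, φ z) - kernelMean 1 (dirDeriv v φ) (truncate u) d z| ≤
        d * (Mf * (‖v‖ * ∫ z, ‖fderiv ℝ ψ z‖)) := fun z hz =>
    (abs_fderiv_sub_kernelMean_le h hu hw hz (hS z hz) hMf v hd0 hd1).trans (by gcongr)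
  have hfar : |kernelMean 1 (dirDeriv v φ) (truncate u) d x -
      kernelMean 1 (dirDeriv v φ) (truncate u) d y| ≤
        ‖v‖ * d * (Mu * (∫ z, ‖iteratedFDeriv ℝ 2 φ z‖) +
          W * ∫ z, ‖iteratedFDeriv ℝ 2 ψ z‖) := by
    set w := x - y with hwdef
    have hwd : ‖w‖ = d := by rw [hd, dist_eq_norm]
    have hp : IsKernelPair 2 (dirDeriv w (dirDeriv v φ)) (dirDeriv w (dirDeriv v ψ)) := by
      simpa using (h.dirDeriv v).dirDeriv w
    have hL0 : ∫ z, dirDeriv w (dirDeriv v ψ) z = 0 :=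
      integral_dirDeriv_eq_zero (h.contDiff_snd.dirDeriv v)
        ((tsupport_dirDeriv_subset _ _).trans h.tsupport_snd) w
    have hder := hasDerivAt_kernelMean_line (m := 1) (h.contDiff_fst.dirDeriv v)
      ((tsupport_dirDeriv_subset _ _).trans h.tsupport_fst)
      (integrable_truncate hu.continuousOn) hd0 y w
    have h2 := norm_image_sub_le_of_norm_deriv_le_segment_01'
      (fun s _ => (hder s).hasDerivWithinAt)
      (C := ‖v‖ * d * (Mu * (∫ z, ‖iteratedFDeriv ℝ 2 φ z‖) +
          W * ∫ z, ‖iteratedFDeriv ℝ 2 ψ z‖)) fun s hs => ?_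
    · simpa [hwdef] using h2
    · have hz : y + s • w ∈ ball (0 : 𝔼) (1 / 2) :=
        (convex_ball (0 : 𝔼) (1 / 2)).add_smul_sub_mem hy hx ⟨hs.1, hs.2.le⟩
      have h3 := abs_kernelMean_two_sub_le hp hL0 hu.continuousOn hf hw hz (hS _ hz) hMf hd0 hd1
        hW0 hW
      have h4 := abs_integral_truncate_mul_le hp.contDiff_fst.continuous hp.tsupport_fst hz
        (hS _ hz) one_pos le_rfl hMu
      have h5 : |kernelMean 2 (dirDeriv w (dirDeriv v φ)) (truncate u) 1 (y + s • w)| ≤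
          Mu * ∫ z, |dirDeriv w (dirDeriv v φ) z| := by
        rw [kernelMean_eq]
        simpa using h4
      have h6 := integral_abs_dirDeriv_dirDeriv_le (μ := volume) h.contDiff_fst
          (hasCompactSupport_of_tsupport_subset_ball h.tsupport_fst) v w
      have h7 := integral_abs_dirDeriv_dirDeriv_le (μ := volume) h.contDiff_snd
          (hasCompactSupport_of_tsupport_subset_ball h.tsupport_snd) v w
      rw [hwd] at h6 h7
      have h8 := mul_le_mul_of_nonneg_left h6 hMu0
      have h9 := mul_le_mul_of_nonneg_right h7 hW0
      rw [Real.norm_eq_abs]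
      have h10 := abs_sub_abs_le_abs_sub
        (kernelMean 2 (dirDeriv w (dirDeriv v φ)) (truncate u) d (y + s • w))
        (kernelMean 2 (dirDeriv w (dirDeriv v φ)) (truncate u) 1 (y + s • w))
      rw [abs_sub_comm] at h10
      change |kernelMean 2 (dirDeriv w (dirDeriv v φ)) (truncate u) d (y + s • w)| ≤ _
      linarith
  have hnx := hnear x hx
  have hny := hnear y hy
  rw [← abs_of_pos hφ, ← abs_mul, sub_mul]
  rw [abs_le] at hnx hny hfar ⊢
  constructor <;> linarith [hnx.1, hnx.2, hny.1, hny.2, hfar.1, hfar.2]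

theorem exists_enorm_fderiv_sub_le (hn : n ≠ 0) :
    ∃ C : ℝ≥0, ∀ (u f : 𝔼 → ℝ) (S : Set 𝔼), ContDiffOn ℝ 1 u (ball 0 1) →
      ContinuousOn f (ball 0 1) → IsWeakPoissonSolution (ball 0 1) u f →
      (∀ x ∈ ball (0 : 𝔼) (1 / 2), ball x (1 / 4) ⊆ S) →
      ∀ x ∈ ball (0 : 𝔼) (1 / 2), ∀ y ∈ ball (0 : 𝔼) (1 / 2),
        ‖fderiv ℝ u x - fderiv ℝ u y‖ₑ ≤ C * edist x y * ((⨆ z ∈ S, ‖u z‖ₑ) + (⨆ z ∈ S, ‖f z‖ₑ) +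
          ∫⁻ r in Ioc (dist x y) 1, modulusOn S f r / ENNReal.ofReal r) := by
  obtain ⟨φ, ψ, h, hφ⟩ := exists_isKernelPair hn
  set a := ∫ z, ‖fderiv ℝ ψ z‖ with ha
  set b := ∫ z, ‖iteratedFDeriv ℝ 2 φ z‖ with hb
  set c := ∫ z, ‖iteratedFDeriv ℝ 2 ψ z‖ with hc
  have ha0 : 0 ≤ a := by positivity
  have hb0 : 0 ≤ b := by positivity
  have hc0 : 0 ≤ c := by positivity
  -- The added `1` makes `C` positive, so that `C * edist x y * ⊤ = ⊤` when the right-hand side is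
  -- infinite.
  set C : ℝ := (2 * a + b + c) / (∫ z, φ z) + 1 with hC
  have hC0 : 0 < C := by positivity
  refine ⟨C.toNNReal, fun u f S hu hf hw hS x hx y hy => ?_⟩
  rcases eq_or_ne x y with rfl | hxy
  · rw [sub_self, ← ofReal_norm, norm_zero, ENNReal.ofReal_zero]
    exact zero_le
  set A₁ := ⨆ z ∈ S, ‖u z‖ₑ with hA₁
  set A₂ := ⨆ z ∈ S, ‖f z‖ₑ with hA₂
  set A₃ := ∫⁻ r in Ioc (dist x y) 1, modulusOn S f r / ENNReal.ofReal r with hA₃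
  by_cases htop : A₁ + A₂ + A₃ = ⊤
  · rw [htop, ENNReal.mul_top]
    · exact le_top
    · refine mul_ne_zero ?_ (edist_pos.2 hxy).ne'
      simpa using hC0
  obtain ⟨⟨h₁, h₂⟩, h₃⟩ : (A₁ ≠ ⊤ ∧ A₂ ≠ ⊤) ∧ A₃ ≠ ⊤ := by
    simpa [ENNReal.add_eq_top, not_or] using htop
  have hbd : ∀ {g : 𝔼 → ℝ} {A : ℝ≥0∞}, A = (⨆ z ∈ S, ‖g z‖ₑ) → A ≠ ⊤ →
      ∀ z ∈ S, |g z| ≤ A.toReal := by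
    intro g A hA hAt z hz
    rw [← ENNReal.ofReal_le_iff_le_toReal hAt, ← Real.enorm_eq_ofReal_abs, hA]
    exact le_iSup₂_of_le z hz le_rfl
  have key := abs_fderiv_sub_fderiv_le h hφ hu hf hw hS hx hy hxy (hbd hA₁ h₁) (hbd hA₂ h₂)
    ENNReal.toReal_nonneg (ENNReal.ofReal_toReal h₃).ge
  have hT : (A₁ + A₂ + A₃).toReal = A₁.toReal + A₂.toReal + A₃.toReal := by
    rw [ENNReal.toReal_add (ENNReal.add_ne_top.2 ⟨h₁, h₂⟩) h₃, ENNReal.toReal_add h₁ h₂]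
  have hnorm : ‖fderiv ℝ u x - fderiv ℝ u y‖ ≤ C * dist x y * (A₁ + A₂ + A₃).toReal := by
    refine ContinuousLinearMap.opNorm_le_bound _ (by positivity) fun v => ?_
    have hk := key v
    rw [← le_div_iff₀ hφ] at hk
    refine hk.trans ?_
    rw [hT]
    have p₁ := ENNReal.toReal_nonneg (a := A₁)
    have p₂ := ENNReal.toReal_nonneg (a := A₂)
    have p₃ := ENNReal.toReal_nonneg (a := A₃)
    have hsum : 2 * A₂.toReal * a + A₁.toReal * b + A₃.toReal * c ≤
        (2 * a + b + c) * (A₁.toReal + A₂.toReal + A₃.toReal) := by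
      have e : (2 * a + b + c) * (A₁.toReal + A₂.toReal + A₃.toReal) =
        2 * A₂.toReal * a + A₁.toReal * b + A₃.toReal * c +
        (A₁.toReal * (2 * a + c) + A₂.toReal * (b + c) + A₃.toReal * (2 * a + b)) := by ring
      rw [e]
      exact le_add_of_nonneg_right (by positivity)
    rw [div_le_iff₀ hφ]
    calc ‖v‖ * dist x y * (2 * A₂.toReal * a + A₁.toReal * b + A₃.toReal * c)
        ≤ ‖v‖ * dist x y * ((2 * a + b + c) * (A₁.toReal + A₂.toReal + A₃.toReal)) := by gcongr
      _ ≤ ‖v‖ * dist x y *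
          (((2 * a + b + c) + ∫ z, φ z) * (A₁.toReal + A₂.toReal + A₃.toReal)) := by
          refine mul_le_mul_of_nonneg_left (mul_le_mul_of_nonneg_right ?_ ?_) ?_
          · linarith
          · positivity
          · positivity
      _ = _ := by
          rw [hC]
          field_simp
  have e1 : (C.toNNReal : ℝ≥0∞) = ENNReal.ofReal C := rfl
  rw [e1, edist_dist, ← ofReal_norm, ← ENNReal.ofReal_toReal htop,
    ← ENNReal.ofReal_mul hC0.le, ← ENNReal.ofReal_mul (by positivity)]
  exact ENNReal.ofReal_le_ofReal hnorm

end Estimates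

/-! ### Moduli of continuity and Dini integrals -/

section Modulus

variable {X Y : Type*} [PseudoMetricSpace X] [PseudoEMetricSpace Y]

theorem edist_le_modulusOn {S : Set X} {g : X → Y} {x y : X} {r : ℝ} (hx : x ∈ S) (hy : y ∈ S)
    (h : dist x y < r) : edist (g x) (g y) ≤ modulusOn S g r :=
  le_iSup₂_of_le x hx (le_iSup₂_of_le y hy (le_iSup_of_le h le_rfl))

theorem modulusOn_le_iff {S : Set X} {g : X → Y} {r : ℝ} {B : ℝ≥0∞} :
    modulusOn S g r ≤ B ↔ ∀ x ∈ S, ∀ y ∈ S, dist x y < r → edist (g x) (g y) ≤ B := by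
  simp [modulusOn]

theorem modulusOn_mono (S : Set X) (g : X → Y) : Monotone (modulusOn S g) := fun _ _ hrs =>
  modulusOn_le_iff.2 fun _ hx _ hy h => edist_le_modulusOn hx hy (h.trans_le hrs)

theorem UniformContinuousOn.exists_modulusOn_le {S : Set X} {g : X → Y}
    (hg : UniformContinuousOn g S) {ε : ℝ≥0∞} (hε : 0 < ε) :
    ∃ δ > 0, ∀ r ≤ δ, modulusOn S g r ≤ ε := by
  have h1 : {p : Y × Y | edist p.1 p.2 < ε} ∈ uniformity Y := edist_mem_uniformity hε
  have h2 := hg h1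
  rw [mem_map, mem_inf_principal, Metric.mem_uniformity_dist] at h2
  obtain ⟨δ, hδ, h⟩ := h2
  refine ⟨δ, hδ, fun r hr => modulusOn_le_iff.2 fun x hx y hy hxy => ?_⟩
  exact le_of_lt (h (hxy.trans_le hr) ⟨hx, hy⟩)

theorem modulusOn_le_two_mul {S : Set X} {g : X → ℝ} {M : ℝ≥0∞} (hM : ∀ z ∈ S, ‖g z‖ₑ ≤ M)
    (r : ℝ) : modulusOn S g r ≤ 2 * M := by
  refine modulusOn_le_iff.2 fun x hx y hy _ => ?_
  rw [edist_eq_enorm_sub, two_mul]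
  exact enorm_sub_le.trans (add_le_add (hM x hx) (hM y hy))

theorem lintegral_inv_Ioc {r : ℝ} (hr : 0 < r) (hr1 : r ≤ 1) :
    ∫⁻ s in Ioc r 1, (ENNReal.ofReal s)⁻¹ = ENNReal.ofReal |Real.log r| := by
  have h1 : ∫⁻ s in Ioc r 1, (ENNReal.ofReal s)⁻¹ = ∫⁻ s in Ioc r 1, ENNReal.ofReal s⁻¹ :=
    setLIntegral_congr_fun measurableSet_Ioc fun s hs =>
      (ENNReal.ofReal_inv_of_pos (hr.trans hs.1)).symm
  have hi : IntegrableOn (fun s : ℝ => s⁻¹) (Ioc r 1) := by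
    rw [← intervalIntegrable_iff_integrableOn_Ioc_of_le hr1]
    refine intervalIntegral.intervalIntegrable_inv (fun s hs => ?_) continuousOn_id
    rw [uIcc_of_le hr1] at hs
    exact (hr.trans_le hs.1).ne'
  rw [h1, ← ofReal_integral_eq_lintegral_ofReal hi
    ((ae_restrict_mem measurableSet_Ioc).mono fun s hs => inv_nonneg.2 (hr.trans hs.1).le),
    ← intervalIntegral.integral_of_le hr1, integral_inv_of_pos hr one_pos,
    abs_of_nonpos (Real.log_nonpos hr.le hr1), one_div, Real.log_inv]

/-- The Dini integral of a modulus is at most logarithmic, with an arbitrarily small factor. -/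
theorem exists_lintegral_modulusOn_div_le {S : Set X} {g : X → ℝ} (hg : UniformContinuousOn g S)
    {M : ℝ≥0∞} (hM : ∀ z ∈ S, ‖g z‖ₑ ≤ M) (hMt : M ≠ ⊤) {ε : ℝ≥0∞} (hε : 0 < ε) :
    ∃ B : ℝ≥0∞, B ≠ ⊤ ∧ ∀ r ∈ Ioc (0 : ℝ) 1,
      ∫⁻ s in Ioc r 1, modulusOn S g s / ENNReal.ofReal s ≤ B + ε * ENNReal.ofReal |Real.log r| := by
  obtain ⟨δ, hδ, hδε⟩ := hg.exists_modulusOn_le hε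
  refine ⟨2 * M / ENNReal.ofReal δ, ENNReal.div_ne_top (ENNReal.mul_ne_top (by simp) hMt)
    (by simpa using hδ), fun r hr => ?_⟩
  -- Below `δ` the modulus is at most `ε`; above `δ` the integrand is bounded independently of `r`.
  have hpt : ∀ s ∈ Ioc r 1, modulusOn S g s / ENNReal.ofReal s ≤
      2 * M / ENNReal.ofReal δ + ε * (ENNReal.ofReal s)⁻¹ := by
    intro s hs
    rcases le_total s δ with h | h
    · exact le_add_left (by rw [div_eq_mul_inv]; gcongr; exact hδε s h)
    · exact le_add_right (ENNReal.div_le_div (modulusOn_le_two_mul hM s)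
        (ENNReal.ofReal_le_ofReal h))
  calc ∫⁻ s in Ioc r 1, modulusOn S g s / ENNReal.ofReal s
      ≤ ∫⁻ s in Ioc r 1, (2 * M / ENNReal.ofReal δ + ε * (ENNReal.ofReal s)⁻¹) :=
        setLIntegral_mono_ae' measurableSet_Ioc (.of_forall hpt)
    _ = 2 * M / ENNReal.ofReal δ * ENNReal.ofReal (1 - r) + ε * ENNReal.ofReal |Real.log r| := by
        rw [lintegral_add_left measurable_const, lintegral_const_mul _ (by fun_prop),
          lintegral_inv_Ioc hr.1 hr.2]
        simp
    _ ≤ _ := by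
        gcongr
        refine mul_le_of_le_one_right' ?_
        rw [ENNReal.ofReal_le_one]
        linarith [hr.1]

/-- Splitting a Dini integral at a larger radius. -/
theorem mul_lintegral_modulusOn_div_le {S : Set X} {g : X → Y} {d r : ℝ} (hd : 0 < d)
    (hdr : d ≤ r) (hr1 : r ≤ 1) :
    ENNReal.ofReal d * ∫⁻ s in Ioc d 1, modulusOn S g s / ENNReal.ofReal s ≤
      ENNReal.ofReal r *
        (modulusOn S g r + ∫⁻ s in Ioc r 1, modulusOn S g s / ENNReal.ofReal s) := by
  have hd' : ENNReal.ofReal d ≠ 0 := by simpa using hd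
  rw [← Ioc_union_Ioc_eq_Ioc hdr hr1, lintegral_union measurableSet_Ioc
    (Ioc_disjoint_Ioc_of_le le_rfl), mul_add, mul_add]
  refine add_le_add ?_ (by gcongr)
  calc ENNReal.ofReal d * ∫⁻ s in Ioc d r, modulusOn S g s / ENNReal.ofReal s
      ≤ ENNReal.ofReal d * ∫⁻ _ in Ioc d r, modulusOn S g r / ENNReal.ofReal d := by
        gcongr ENNReal.ofReal d * ?_
        exact setLIntegral_mono_ae' measurableSet_Ioc (.of_forall fun s hs =>
          ENNReal.div_le_div (modulusOn_mono S g hs.2) (ENNReal.ofReal_le_ofReal hs.1.le))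
    _ = modulusOn S g r * ENNReal.ofReal (r - d) := by
        rw [setLIntegral_const, Real.volume_Ioc, ← mul_assoc,
          ENNReal.mul_div_cancel hd' ENNReal.ofReal_ne_top]
    _ ≤ ENNReal.ofReal r * modulusOn S g r := by
        rw [mul_comm]
        gcongr
        linarith

end Modulus

/-! ### The `o(r log r)` modulus and the conclusion -/

theorem tendsto_modulusOn_fderiv_div {n : ℕ} {C : ℝ≥0} {u f : EuclideanSpace ℝ (Fin n) → ℝ}
    (hu : ContinuousOn u (ball 0 1)) (hf : ContinuousOn f (ball 0 1))
    (h : ∀ x ∈ ball (0 : EuclideanSpace ℝ (Fin n)) (1 / 2),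
      ∀ y ∈ ball (0 : EuclideanSpace ℝ (Fin n)) (1 / 2),
        ‖fderiv ℝ u x - fderiv ℝ u y‖ₑ ≤ C * edist x y *
          ((⨆ z ∈ closedBall (0 : EuclideanSpace ℝ (Fin n)) (3 / 4), ‖u z‖ₑ) +
            (⨆ z ∈ closedBall (0 : EuclideanSpace ℝ (Fin n)) (3 / 4), ‖f z‖ₑ) +
            ∫⁻ r in Ioc (dist x y) 1,
              modulusOn (closedBall 0 (3 / 4)) f r / ENNReal.ofReal r)) :
    Tendsto (fun r : ℝ => modulusOn (ball 0 (1 / 2)) (fderiv ℝ u) r /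
      ENNReal.ofReal (r * |Real.log r|)) (𝓝[>] 0) (𝓝 0) := by
  set S : Set (EuclideanSpace ℝ (Fin n)) := closedBall 0 (3 / 4) with hS
  have hSc : IsCompact S := isCompact_closedBall _ _
  have hS1 : S ⊆ ball 0 1 := closedBall_subset_ball (by norm_num)
  have hfin : ∀ {g : EuclideanSpace ℝ (Fin n) → ℝ}, ContinuousOn g (ball 0 1) →
      (⨆ z ∈ S, ‖g z‖ₑ) ≠ ⊤ := by
    intro g hg
    obtain ⟨M, hM⟩ := hSc.exists_bound_of_continuousOn (hg.mono hS1)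
    refine ((iSup₂_le fun z hz => ?_).trans_lt (ENNReal.ofReal_lt_top (r := M))).ne
    rw [← ofReal_norm]
    exact ENNReal.ofReal_le_ofReal (hM z hz)
  set A := (⨆ z ∈ S, ‖u z‖ₑ) + ⨆ z ∈ S, ‖f z‖ₑ with hA
  set M := ⨆ z ∈ S, ‖f z‖ₑ with hM
  have hAt : A ≠ ⊤ := ENNReal.add_ne_top.2 ⟨hfin hu, hfin hf⟩
  have hMt : M ≠ ⊤ := hfin hf
  have hfM : ∀ z ∈ S, ‖f z‖ₑ ≤ M := fun z hz => le_iSup₂_of_le z hz le_rfl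
  -- The pointwise estimate involves `d = |x - y| < r`, so the Dini integral from `d` must be traded
  -- for the one from `r`; the excess is at most `r ω(r) ≤ 2 * M * r`.
  have hmod : ∀ r ∈ Ioc (0 : ℝ) 1, modulusOn (ball 0 (1 / 2)) (fderiv ℝ u) r ≤
      C * (ENNReal.ofReal r *
        (A + 2 * M + ∫⁻ s in Ioc r 1, modulusOn S f s / ENNReal.ofReal s)) := by
    intro r hr
    refine modulusOn_le_iff.2 fun x hx y hy hxy => ?_
    rw [edist_eq_enorm_sub]
    refine (h x hx y hy).trans ?_
    rw [mul_assoc, edist_dist]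
    gcongr C * ?_
    rcases (dist_nonneg (x := x) (y := y)).eq_or_lt with h0 | h0
    · simp [← h0]
    · rw [add_assoc A, mul_add, mul_add (ENNReal.ofReal r)]
      refine add_le_add (by gcongr) ((mul_lintegral_modulusOn_div_le h0 hxy.le hr.2).trans ?_)
      gcongr
      exact modulusOn_le_two_mul hfM r
  rw [ENNReal.tendsto_nhds_zero]
  intro ε hε
  -- One `η |log r|` comes from the Dini integral; the other absorbs the constants `A + 2 * M + B`
  -- for small `r`.
  obtain ⟨η, hη, hηε⟩ : ∃ η : ℝ≥0∞, 0 < η ∧ C * (2 * η) ≤ ε := by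
    rcases eq_or_ne ε ⊤ with rfl | hεt
    · exact ⟨1, one_pos, le_top⟩
    · refine ⟨ε / (2 * (C + 1)), ENNReal.div_pos hε.ne'
        (ENNReal.mul_ne_top (by simp) (by simp)), ?_⟩
      calc C * (2 * (ε / (2 * (C + 1)))) ≤ (2 * (C + 1)) * (ε / (2 * (C + 1))) := by
            rw [← mul_assoc, mul_comm (C : ℝ≥0∞) 2]
            gcongr
            exact le_self_add
        _ ≤ ε := ENNReal.mul_div_le
  obtain ⟨B, hB, hBr⟩ := exists_lintegral_modulusOn_div_le
    (hSc.uniformContinuousOn_of_continuous (hf.mono hS1)) hfM hMt hη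
  have hlog : Tendsto (fun r : ℝ => η * ENNReal.ofReal |Real.log r|) (𝓝[>] 0) (𝓝 ⊤) := by
    have h1 : Tendsto (fun r : ℝ => ENNReal.ofReal |Real.log r|) (𝓝[>] 0) (𝓝 ⊤) :=
      ENNReal.tendsto_ofReal_atTop.comp
        (tendsto_abs_atBot_atTop.comp Real.tendsto_log_nhdsGT_zero)
    have h2 := ENNReal.Tendsto.const_mul (a := η) h1 (Or.inl (by simp))
    rwa [ENNReal.mul_top hη.ne'] at h2
  have hK : A + 2 * M + B ≠ ⊤ :=
    ENNReal.add_ne_top.2 ⟨ENNReal.add_ne_top.2 ⟨hAt, ENNReal.mul_ne_top (by simp) hMt⟩, hB⟩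
  filter_upwards [hlog.eventually (lt_mem_nhds hK.lt_top), Ioo_mem_nhdsGT one_pos] with r hr hr01
  have hl : 0 < |Real.log r| := abs_pos.2 (Real.log_neg hr01.1 hr01.2).ne
  refine ENNReal.div_le_of_le_mul ?_
  refine (hmod r ⟨hr01.1, hr01.2.le⟩).trans ?_
  calc C * (ENNReal.ofReal r *
        (A + 2 * M + ∫⁻ s in Ioc r 1, modulusOn S f s / ENNReal.ofReal s))
      ≤ C * (ENNReal.ofReal r * (η * ENNReal.ofReal |Real.log r| +
          η * ENNReal.ofReal |Real.log r|)) := by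
        gcongr C * (_ * ?_)
        refine (add_le_add_right (hBr r ⟨hr01.1, hr01.2.le⟩) _).trans ?_
        rw [← add_assoc]
        exact add_le_add_left hr.le _
    _ = C * (2 * η) * (ENNReal.ofReal (r * |Real.log r|)) := by
        rw [ENNReal.ofReal_mul hr01.1.le]
        ring
    _ ≤ ε * ENNReal.ofReal (r * |Real.log r|) := by gcongr

theorem mainTheorem3 (n : ℕ) :
    ∃ C : ℝ≥0, ∀ u f : EuclideanSpace ℝ (Fin n) → ℝ,
      ContDiffOn ℝ 1 u (ball 0 1) →
      ContinuousOn f (ball 0 1) →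
      IsWeakPoissonSolution (ball 0 1) u f →
      (∀ x ∈ ball (0 : EuclideanSpace ℝ (Fin n)) (1 / 2),
        ∀ y ∈ ball (0 : EuclideanSpace ℝ (Fin n)) (1 / 2),
          ‖fderiv ℝ u x - fderiv ℝ u y‖ₑ ≤
            C * edist x y *
              ((⨆ z ∈ ball (0 : EuclideanSpace ℝ (Fin n)) 1, ‖u z‖ₑ) +
                (⨆ z ∈ ball (0 : EuclideanSpace ℝ (Fin n)) 1, ‖f z‖ₑ) +
                ∫⁻ r in Ioc (dist x y) 1, modulusOn (ball 0 1) f r / ENNReal.ofReal r)) ∧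
      Tendsto
        (fun r : ℝ => modulusOn (ball 0 (1 / 2)) (fderiv ℝ u) r /
          ENNReal.ofReal (r * |Real.log r|))
        (𝓝[>] 0) (𝓝 0) := by
  obtain ⟨C, hC⟩ : ∃ C : ℝ≥0, ∀ (u f : EuclideanSpace ℝ (Fin n) → ℝ)
      (S : Set (EuclideanSpace ℝ (Fin n))), ContDiffOn ℝ 1 u (ball 0 1) →
      ContinuousOn f (ball 0 1) → IsWeakPoissonSolution (ball 0 1) u f →
      (∀ x ∈ ball (0 : EuclideanSpace ℝ (Fin n)) (1 / 2), ball x (1 / 4) ⊆ S) →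
      ∀ x ∈ ball (0 : EuclideanSpace ℝ (Fin n)) (1 / 2),
        ∀ y ∈ ball (0 : EuclideanSpace ℝ (Fin n)) (1 / 2),
        ‖fderiv ℝ u x - fderiv ℝ u y‖ₑ ≤ C * edist x y * ((⨆ z ∈ S, ‖u z‖ₑ) + (⨆ z ∈ S, ‖f z‖ₑ) +
          ∫⁻ r in Ioc (dist x y) 1, modulusOn S f r / ENNReal.ofReal r) := by
    -- In dimension zero the space is a point, and any constant works.
    rcases eq_or_ne n 0 with rfl | hn
    · refine ⟨0, fun u f S _ _ _ _ x _ y _ => ?_⟩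
      rw [Subsingleton.elim x y, sub_self, ← ofReal_norm, norm_zero, ENNReal.ofReal_zero]
      exact zero_le
    · exact exists_enorm_fderiv_sub_le hn
  have hsub : ∀ x ∈ ball (0 : EuclideanSpace ℝ (Fin n)) (1 / 2),
      ball x (1 / 4) ⊆ closedBall 0 (3 / 4) := fun x hx => by
    refine ball_subset_closedBall.trans (closedBall_subset_closedBall' ?_)
    have := mem_ball.1 hx
    linarith
  refine ⟨C, fun u f hu hf hw => ⟨hC u f _ hu hf hw fun x hx =>
    (hsub x hx).trans (closedBall_subset_ball (by norm_num)), ?_⟩⟩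
  exact tendsto_modulusOn_fderiv_div hu.continuousOn hf (hC u f _ hu hf hw hsub)
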